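/- Let $(\mathbf{k},\phi)$ be a difference field of characteristic zero, i.e. a field with an automorphism $\phi$, and assume that its field of constants $C=\{c\in\mathbf{k}:\phi(c)=c\}$ is algebraically closed, that $\mathbf{k}$ is a $\mathcal{C}^1$-field (every non-constant homogeneous polynomial over $\mathbf{k}$ in more variables than its degree has a nontrivial zero), and that $\mathbf{k}$ is the only finite difference field extension of $(\mathbf{k},\phi)$. For $A\in\mathrm{GL}_n(\mathbf{k})$ write $[A]$ for the system $\phi(Y)=AY$. A Picard--Vessiot ring for $[A]$ is a nonzero difference ring extension $(\mathbf{L},\phi)$ of $(\mathbf{k},\phi)$ whose only difference ideals (ideals $I$ with $\phi(I)\subset I$) are $\{0\}$ and $\mathbf{L}$, and which is generated as a $\mathbf{k}$-algebra by the entries of $U$ and by $\det(U)^{-1}$ for some $U\in\mathrm{GL}_n(\mathbf{L})$ with $\phi(U)=AU$. The difference Galois group $G$ of $[A]$ is the group of $\mathbf{k}$-algebra automorphisms of $\mathbf{L}$ commuting with $\phi$; via $\sigma\mapsto U^{-1}\sigma(U)$ it is identified, up to conjugation, with an algebraic subgroup of $\mathrm{GL}_n(C)$. The system $[A]$ is in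 reduced form if $A\in G(\mathbf{k})$, and $[B]$ is a reduced form of $[A]$ with gauge transformation $T\in\mathrm{GL}_n(\mathbf{k})$ if $B=\phi(T)AT^{-1}$ and $[B]$ is in reduced form. Let $\alpha\in\mathbf{k}^*$, let $\ell\ge 1$ be an integer, and let $G$ be the difference Galois group over $\mathbf{k}$ of the order one equation $\phi(y)=\alpha y$. Then $G\cong\mathbb{Z}/\ell\mathbb{Z}$ if and only if there exist a primitive $\ell$-th root of unity $\zeta\in\mathbf{k}$ and $f\in\mathbf{k}^*$ such that $\phi(f)=(\zeta/\alpha)f$. Moreover, for every such $\zeta$ and $f$ one has $\zeta=\alpha\,\phi(f)/f$, and $[\zeta]$ is a reduced form of $[\alpha]$ with gauge transformation $(f)$. -/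

import Mathlib

namespace DifferenceGalois

universe u v

/-- The field of constants of the difference field `(k, φ)`. -/
def constants {k : Type u} [Field k] (φ : k ≃+* k) : Subfield k where
  carrier := {c | φ c = c}
  mul_mem' {a b} ha hb := by
    simp only [Set.mem_ofPred_eq] at ha hb ⊢
    rw [map_mul, ha, hb]
  one_mem' := map_one φ
  add_mem' {a b} ha hb := by
    simp only [Set.mem_ofPred_eq] at ha hb ⊢
    rw [map_add, ha, hb]
  zero_mem' := map_zero φ
  neg_mem' {a} ha := by
    simp only [Set.mem_ofPred_eq] at ha ⊢
    rw [map_neg, ha]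
  inv_mem' a ha := by
    simp only [Set.mem_ofPred_eq] at ha ⊢
    rw [map_inv₀, ha]

/-- `k` is a `C¹`-field: every non-constant homogeneous polynomial whose number of variables
exceeds its degree has a nontrivial zero. -/
def IsC1Field (k : Type u) [Field k] : Prop :=
  ∀ (n d : ℕ), 0 < d → d < n → ∀ P : MvPolynomial (Fin n) k, P.IsHomogeneous d →
    ∃ x : Fin n → k, x ≠ 0 ∧ MvPolynomial.eval x P = 0

/-- The automorphism `Φ` of the `k`-algebra `L` extends the automorphism `φ` of `k`. -/
def Extends {k : Type u} {L : Type v} [Field k] [CommRing L] [Algebra k L]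
    (φ : k ≃+* k) (Φ : L ≃+* L) : Prop :=
  ∀ x : k, Φ (algebraMap k L x) = algebraMap k L (φ x)

/-- `k` is the only finite difference field extension of `(k, φ)`. (A finite extension of `k` is
isomorphic to one in the universe of `k`.) -/
def NoProperFiniteExtension {k : Type u} [Field k] (φ : k ≃+* k) : Prop :=
  ∀ (K : Type u) [Field K] [Algebra k K] [FiniteDimensional k K] (Φ : K ≃+* K),
    Extends φ Φ → Function.Surjective (algebraMap k K)

variable {k : Type u} {L : Type v} [Field k] [CommRing L] [Algebra k L] {n : ℕ}

/-- `U ∈ GL_n(L)` is a fundamental matrix of solutions of `φ(Y) = AY`, `A ∈ GL_n(k)`. -/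
def IsFundamentalMatrix (Φ : L ≃+* L) (A : GL (Fin n) k) (U : GL (Fin n) L) : Prop :=
  U.val.map Φ = A.val.map (algebraMap k L) * U.val

/-- `(L, Φ)` is a Picard-Vessiot ring for the system `φ(Y) = AY` over `(k, φ)`. -/
structure IsPicardVessiotRing (φ : k ≃+* k) (Φ : L ≃+* L) (A : GL (Fin n) k) : Prop where
  nontrivial : Nontrivial L
  extends_base : Extends φ Φ
  exists_fundamental : ∃ U : GL (Fin n) L, IsFundamentalMatrix Φ A U ∧
    Algebra.adjoin k
      (Set.range (fun p : Fin n × Fin n => U.val p.1 p.2) ∪ {(U⁻¹).val.det}) = ⊤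
  simple : ∀ I : Ideal L, (∀ x ∈ I, Φ x ∈ I) → I = ⊥ ∨ I = ⊤

/-- The group of `k`-linear automorphisms of `L` that commute with `Φ`; it is the difference
Galois group when `L` is a Picard-Vessiot ring. -/
def galoisGroup (k : Type u) {L : Type v} [Field k] [CommRing L] [Algebra k L]
    (Φ : L ≃+* L) : Subgroup (L ≃ₐ[k] L) where
  carrier := {σ | ∀ x : L, σ (Φ x) = Φ (σ x)}
  mul_mem' {σ τ} hσ hτ x := by
    rw [AlgEquiv.mul_apply, AlgEquiv.mul_apply, hτ x, hσ (τ x)]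
  one_mem' _ := rfl
  inv_mem' {σ} hσ x := by
    apply σ.injective
    rw [hσ, ← AlgEquiv.mul_apply, ← AlgEquiv.mul_apply, mul_inv_cancel]
    rfl

/-- The image of the Galois group under the representation `σ ↦ U⁻¹ σ(U)` in `GL_n(C)`, where
`C` is the field of constants of `k`. -/
def galoisImage (φ : k ≃+* k) (Φ : L ≃+* L) (U : GL (Fin n) L) :
    Set (GL (Fin n) (constants φ)) :=
  {M | ∃ σ ∈ galoisGroup k Φ,
    (U⁻¹).val * U.val.map σ = M.val.map (fun c => algebraMap k L (c : k))}

/-- The `k`-points `G(k)` of a Zariski closed subset `G` of `GL_n(C)`: the matrices in `GL_n(k)`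
at which every polynomial over `C` that vanishes on `G` vanishes. -/
def points (φ : k ≃+* k) (G : Set (GL (Fin n) (constants φ))) : Set (GL (Fin n) k) :=
  {A | ∀ P : MvPolynomial (Fin n × Fin n) (constants φ),
    (∀ M ∈ G, MvPolynomial.eval (fun p => M.val p.1 p.2) P = 0) →
      MvPolynomial.aeval (fun p => A.val p.1 p.2) P = 0}

/-- The system `φ(Y) = AY`, with Picard-Vessiot ring `(L, Φ)`, is in reduced form: `A ∈ G(k)`,
where `G ⊆ GL_n(C)` is its Galois group, realised through some fundamental matrix. -/
def IsReducedSystem (φ : k ≃+* k) (Φ : L ≃+* L) (A : GL (Fin n) k) : Prop :=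
  IsPicardVessiotRing φ Φ A ∧
    ∃ U : GL (Fin n) L, IsFundamentalMatrix Φ A U ∧ A ∈ points φ (galoisImage φ Φ U)

/-- `φ(T) A T⁻¹`, the matrix of the system satisfied by `TY` when `φ(Y) = AY`. -/
def gaugeTransform (φ : k ≃+* k) (T A : GL (Fin n) k) : GL (Fin n) k :=
  Matrix.GeneralLinearGroup.map (φ : k →+* k) T * A * T⁻¹

/-- `[B]` is a reduced form of `[A]` with gauge transformation `T`. -/
def IsReducedFormVia (φ : k ≃+* k) (Φ : L ≃+* L) (A B T : GL (Fin n) k) : Prop :=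
  B = gaugeTransform φ T A ∧ IsReducedSystem φ Φ B

/-- The matrix `(a) ∈ GL_1(k)`; the equation `φ(y) = a y` is the system `[(a)]`. -/
def orderOne (a : kˣ) : GL (Fin 1) k :=
  Matrix.GeneralLinearGroup.scalar (Fin 1) a

end DifferenceGalois

/-! A Picard–Vessiot ring here is generated by a unit `u` with `Φ u = α u` and its inverse. By
simplicity a `Φ`-invariant element is 0 or a unit; if it is also integral over `k`, it lies in `C`,
because its minimal polynomial splits over `C` (`exists_constant_of_isIntegral`).

If `G` is finite then `u` is integral, since otherwise `u ↦ 2u` has infinite order in `G`. Let `d`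
be the degree of its minimal polynomial. The constant coefficient `a` satisfies `φ a = α ^ d * a`,
so `u ^ d / a` is a constant, the minimal polynomial is `X ^ d - g`, and `σ ↦ σ u / u` identifies
`G` with the `d`-th roots of unity. As `φ g = α ^ d * g`, adjoining a `d`-th root of `g` gives a
finite difference extension, so `g = y ^ d` with `y` in `k`; take `f = y⁻¹` and `ζ = α y / φ y`.

Conversely, `ζ` and `f` force `u` to be integral with `d = ℓ` (`natDegree_minpoly_eq`). For the
reduced form, `f u` solves the equation of `ζ`, and `u ↦ ζ u` is an element of `G`. -/

namespace DifferenceGalois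

open Polynomial

/-- `(L, Φ)` is a simple difference ring extension of `(k, φ)` generated as a `k`-algebra by a
unit `u` with `Φ u = α u` and its inverse. -/
structure IsExponentialExtension {k : Type*} {L : Type*} [Field k] [CommRing L] [Algebra k L]
    (φ : k ≃+* k) (Φ : L ≃+* L) (α : kˣ) (u : Lˣ) : Prop where
  nontrivial : Nontrivial L
  extends_base : Extends φ Φ
  map_unit : Φ u = algebraMap k L α * u
  adjoin_eq_top : Algebra.adjoin k {(u : L), ((u⁻¹ : Lˣ) : L)} = ⊤
  simple : ∀ I : Ideal L, (∀ x ∈ I, Φ x ∈ I) → I = ⊥ ∨ I = ⊤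

/-! ### Minimal polynomials of eigenvectors of `Φ` -/

section Minpoly

variable {k : Type*} {L : Type*} [Field k] [CommRing L] [Algebra k L] {φ : k ≃+* k} {Φ : L ≃+* L}

theorem aeval_map_extends (hext : Extends φ Φ) (x : L) (p : k[X]) :
    aeval (Φ x) (p.map (φ : k →+* k)) = Φ (aeval x p) := by
  rw [aeval_def, aeval_def, eval₂_map, ← RingEquiv.coe_toRingHom Φ, hom_eval₂]
  congr 1
  ext y
  exact (hext y).symm

/-- Applying `φ` to the coefficients gives a monic polynomial killing `a x`; rescaling its roots by
`a⁻¹` gives one of the same degree killing `x`, so it is the minimal polynomial again. No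
irreducibility is needed, as `L` may have zero divisors. -/
theorem map_coeff_minpoly (hext : Extends φ Φ) {x : L} (hx : IsIntegral k x) {a : k} (ha : a ≠ 0)
    (hxa : Φ x = algebraMap k L a * x) (i : ℕ) :
    φ ((minpoly k x).coeff i) =
      a ^ ((minpoly k x).natDegree - i) * (minpoly k x).coeff i := by
  set p := minpoly k x with hp
  have hmonic : p.Monic := minpoly.monic hx
  set q : k[X] := (p.map (φ : k →+* k)).scaleRoots a⁻¹ with hq
  have hdeg : q.natDegree = p.natDegree := by
    rw [hq, natDegree_scaleRoots, natDegree_map]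
  have hqm : q.Monic := (monic_scaleRoots_iff _).2 (hmonic.map _)
  have hroot : aeval x q = 0 := by
    have h := scaleRoots_aeval_eq_zero (r := a⁻¹) (p := p.map (φ : k →+* k)) (a := Φ x) (by
      rw [aeval_map_extends hext, hp, minpoly.aeval, map_zero])
    rwa [hxa, ← mul_assoc, ← map_mul, inv_mul_cancel₀ ha, map_one, one_mul] at h
  have hqp : q = p := by
    apply minpoly.unique_of_degree_le_degree_minpoly k x hqm hroot
    rw [← hp, degree_eq_natDegree hqm.ne_zero, degree_eq_natDegree hmonic.ne_zero, hdeg]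
  have hc : q.coeff i = p.coeff i := by rw [hqp]
  rw [hq, coeff_scaleRoots, natDegree_map, coeff_map, RingEquiv.coe_toRingHom, inv_pow] at hc
  rw [mul_comm]
  exact (mul_inv_eq_iff_eq_mul₀ (pow_ne_zero _ ha)).1 hc

end Minpoly

/-! ### Constants and automorphisms of an exponential extension -/

namespace IsExponentialExtension

variable {k : Type*} {L : Type*} [Field k] [CommRing L] [Algebra k L] {φ : k ≃+* k} {Φ : L ≃+* L}
  {α : kˣ} {u : Lˣ}

theorem eq_zero_or_isUnit_of_constant (h : IsExponentialExtension φ Φ α u) {x : L}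
    (hx : Φ x = x) : x = 0 ∨ IsUnit x := by
  rcases h.simple (Ideal.span {x}) (fun y hy => by
    obtain ⟨z, rfl⟩ := Ideal.mem_span_singleton'.1 hy
    rw [map_mul, hx]
    exact Ideal.mul_mem_left _ _ (Ideal.mem_span_singleton_self x)) with h | h
  · exact Or.inl (Ideal.span_singleton_eq_bot.1 h)
  · exact Or.inr (Ideal.span_singleton_eq_top.1 h)

theorem exists_eq_of_prod_eq_zero (h : IsExponentialExtension φ Φ α u) {x : L} (hx : Φ x = x)
    (s : Multiset (constants φ))
    (hs : (s.map fun c : constants φ => x - algebraMap k L (c : k)).prod = 0) :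
    ∃ c : constants φ, x = algebraMap k L (c : k) := by
  have := h.nontrivial
  induction s using Multiset.induction with
  | empty => simp at hs
  | cons c s ih =>
    rw [Multiset.map_cons, Multiset.prod_cons] at hs
    rcases h.eq_zero_or_isUnit_of_constant (x := x - algebraMap k L (c : k)) (by
      rw [map_sub, hx, h.extends_base, c.2]) with h0 | hu
    · exact ⟨c, sub_eq_zero.1 h0⟩
    · exact ih ((hu.mul_right_eq_zero).1 hs)

theorem exists_constant_of_isIntegral (h : IsExponentialExtension φ Φ α u)
    [IsAlgClosed (constants φ)] {x : L} (hx : Φ x = x) (hint : IsIntegral k x) :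
    ∃ c : constants φ, x = algebraMap k L (c : k) := by
  have hcoeff : ∀ i, φ ((minpoly k x).coeff i) = (minpoly k x).coeff i := fun i => by
    -- An invariant element is an eigenvector with `a = 1`.
    simpa using map_coeff_minpoly h.extends_base hint one_ne_zero (by simpa using hx) i
  have hlift : minpoly k x ∈ lifts (constants φ).subtype := by
    rw [lifts_iff_coeff_lifts]
    intro i
    exact ⟨⟨_, hcoeff i⟩, rfl⟩
  obtain ⟨q, hq, -, hqm⟩ := lifts_and_natDegree_eq_and_monic hlift (minpoly.monic hint)
  have hprod := (IsAlgClosed.splits q).eq_prod_roots_of_monic hqm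
  apply h.exists_eq_of_prod_eq_zero hx q.roots
  have h0 : eval₂ ((algebraMap k L).comp (constants φ).subtype) x q = 0 := by
    rw [← eval₂_map, hq]
    exact minpoly.aeval k x
  rw [hprod, ← coe_eval₂RingHom, map_multiset_prod, Multiset.map_map] at h0
  simpa using h0

theorem ringHom_ext (h : IsExponentialExtension φ Φ α u) {R : Type*} [CommRing R]
    {f g : L →+* R} (hk : ∀ x, f (algebraMap k L x) = g (algebraMap k L x))
    (hu : f u = g u) (x : L) : f x = g x := by
  have hx : x ∈ Algebra.adjoin k {(u : L), ((u⁻¹ : Lˣ) : L)} := by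
    rw [h.adjoin_eq_top]; trivial
  have hu' : Units.map (f : L →* R) u = Units.map (g : L →* R) u := Units.ext hu
  induction hx using Algebra.adjoin_induction with
  | mem x hx =>
    rcases hx with rfl | rfl
    · exact hu
    · simpa using congrArg (fun w : Rˣ => ((w⁻¹ : Rˣ) : R)) hu'
  | algebraMap r => exact hk r
  | add x y _ _ hx hy => rw [map_add, map_add, hx, hy]
  | mul x y _ _ hx hy => rw [map_mul, map_mul, hx, hy]

theorem galoisGroup_ext (h : IsExponentialExtension φ Φ α u) {σ τ : galoisGroup k Φ}
    (hu : (σ : L ≃ₐ[k] L) u = (τ : L ≃ₐ[k] L) u) : σ = τ := by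
  apply Subtype.ext
  ext x
  exact h.ringHom_ext (f := ((σ : L ≃ₐ[k] L) : L →+* L)) (g := ((τ : L ≃ₐ[k] L) : L →+* L))
    (fun x => by simp) (by simpa using hu) x

theorem exists_mul_pow_eq_aeval (h : IsExponentialExtension φ Φ α u) (x : L) :
    ∃ (N : ℕ) (p : k[X]), x * (u : L) ^ N = aeval (u : L) p := by
  have hx : x ∈ Algebra.adjoin k {(u : L), ((u⁻¹ : Lˣ) : L)} := by
    rw [h.adjoin_eq_top]; trivial
  induction hx using Algebra.adjoin_induction with
  | mem x hx =>
    rcases hx with rfl | rfl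
    · exact ⟨0, X, by simp⟩
    · exact ⟨1, 1, by simp⟩
  | algebraMap r => exact ⟨0, C r, by simp⟩
  | add x y _ _ hx hy =>
    obtain ⟨N, p, hp⟩ := hx
    obtain ⟨M, q, hq⟩ := hy
    refine ⟨N + M, p * X ^ M + q * X ^ N, ?_⟩
    simp only [map_add, map_mul, map_pow, aeval_X, ← hp, ← hq]
    ring
  | mul x y _ _ hx hy =>
    obtain ⟨N, p, hp⟩ := hx
    obtain ⟨M, q, hq⟩ := hy
    refine ⟨N + M, p * q, ?_⟩
    simp only [map_mul, ← hp, ← hq]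
    ring

/-- The evaluation at the unit `v` of Laurent polynomials. -/
noncomputable def laurentEval (k : Type*) {L : Type*} [Field k] [CommRing L] [Algebra k L]
    (v : Lˣ) : LaurentPolynomial k →ₐ[k] L :=
  { LaurentPolynomial.eval₂ (algebraMap k L) v with
    commutes' := fun r => LaurentPolynomial.eval₂_C (algebraMap k L) v r }

theorem laurentEval_toLaurent (v : Lˣ) (p : k[X]) :
    laurentEval k v (toLaurent p) = aeval (v : L) p :=
  LaurentPolynomial.eval₂_toLaurent (algebraMap k L) v p

theorem laurentEval_T (v : Lˣ) (n : ℤ) :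
    laurentEval k v (LaurentPolynomial.T n) = ((v ^ n : Lˣ) : L) :=
  LaurentPolynomial.eval₂_T (algebraMap k L) v n

theorem laurentEval_surjective (h : IsExponentialExtension φ Φ α u) :
    Function.Surjective (laurentEval k u) := by
  rw [← AlgHom.range_eq_top, eq_top_iff, ← h.adjoin_eq_top, Algebra.adjoin_le_iff]
  rintro x (rfl | rfl)
  · exact ⟨LaurentPolynomial.T 1, (laurentEval_T u 1).trans (by rw [zpow_one])⟩
  · exact ⟨LaurentPolynomial.T (-1), (laurentEval_T u (-1)).trans (by rw [zpow_neg_one])⟩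

/-- `L` is a quotient of the Laurent polynomials, and multiplying by a power of `T` turns a relation
between powers of `u` into an ordinary polynomial one. -/
theorem exists_algHom (h : IsExponentialExtension φ Φ α u) (v : Lˣ)
    (hv : ∀ p : k[X], aeval (u : L) p = 0 → aeval (v : L) p = 0) :
    ∃ f : L →ₐ[k] L, f u = v := by
  have hker : RingHom.ker (laurentEval k u).toRingHom ≤
      RingHom.ker (laurentEval k v).toRingHom := by
    intro q hq
    have hq' : laurentEval k u q = 0 := RingHom.mem_ker.1 hq
    obtain ⟨n, p, hp⟩ := q.exists_T_pow
    have h1 : aeval (v : L) p = 0 := by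
      apply hv
      rw [← laurentEval_toLaurent, hp, map_mul, hq', zero_mul]
    rw [← laurentEval_toLaurent, hp, map_mul, laurentEval_T] at h1
    exact RingHom.mem_ker.2 ((Units.mul_left_eq_zero _).1 h1)
  have h1 := AlgHom.liftOfSurjective_apply (laurentEval k u) h.laurentEval_surjective
    (laurentEval k v) hker (LaurentPolynomial.T 1)
  rw [laurentEval_T, laurentEval_T, zpow_one, zpow_one] at h1
  exact ⟨_, h1⟩

theorem exists_mem_galoisGroup (h : IsExponentialExtension φ Φ α u) (c : kˣ) (hc : φ c = c)
    (h₁ : ∀ p : k[X], aeval (u : L) p = 0 → aeval (algebraMap k L c * u) p = 0)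
    (h₂ : ∀ p : k[X], aeval (u : L) p = 0 →
      aeval (algebraMap k L ((c⁻¹ : kˣ) : k) * u) p = 0) :
    ∃ σ : galoisGroup k Φ, (σ : L ≃ₐ[k] L) u = algebraMap k L c * u := by
  obtain ⟨f, hf⟩ := h.exists_algHom (Units.map (algebraMap k L : k →* L) c * u) (by simpa using h₁)
  obtain ⟨g, hg⟩ := h.exists_algHom (Units.map (algebraMap k L : k →* L) c⁻¹ * u)
    (by simpa using h₂)
  simp only [Units.val_mul, Units.coe_map, MonoidHom.coe_coe] at hf hg
  have hfg : f.comp g = AlgHom.id k L := by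
    ext x
    refine h.ringHom_ext (f := (f.comp g : L →+* L)) (g := (AlgHom.id k L : L →+* L))
      (fun x => by simp) ?_ x
    rw [AlgHom.coe_toRingHom, AlgHom.coe_toRingHom, AlgHom.comp_apply, hg, map_mul,
      AlgHom.commutes, hf, ← mul_assoc, ← map_mul, Units.inv_mul, map_one, one_mul, AlgHom.id_apply]
  have hgf : g.comp f = AlgHom.id k L := by
    ext x
    refine h.ringHom_ext (f := (g.comp f : L →+* L)) (g := (AlgHom.id k L : L →+* L))
      (fun x => by simp) ?_ x
    rw [AlgHom.coe_toRingHom, AlgHom.coe_toRingHom, AlgHom.comp_apply, hf, map_mul,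
      AlgHom.commutes, hg, ← mul_assoc, ← map_mul, Units.mul_inv, map_one, one_mul, AlgHom.id_apply]
  refine ⟨⟨AlgEquiv.ofAlgHom f g hfg hgf, fun x => ?_⟩, hf⟩
  refine h.ringHom_ext (f := (f : L →+* L).comp (Φ : L →+* L))
    (g := (Φ : L →+* L).comp (f : L →+* L)) (fun x => ?_) ?_ x
  · simp [h.extends_base x]
  · simp [hf, h.map_unit, h.extends_base _, hc]
    ring

theorem pow_apply_unit {σ : galoisGroup k Φ} {c : kˣ}
    (hσ : (σ : L ≃ₐ[k] L) u = algebraMap k L c * u) (n : ℕ) :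
    ((σ ^ n : galoisGroup k Φ) : L ≃ₐ[k] L) u = algebraMap k L ((c ^ n : kˣ) : k) * u := by
  induction n with
  | zero => simp
  | succ n ih =>
    rw [pow_succ, Subgroup.coe_mul, AlgEquiv.mul_apply, hσ, map_mul, AlgEquiv.commutes, ih,
      ← mul_assoc, ← map_mul, pow_succ, mul_comm c.val, Units.val_mul]

theorem orderOf_galoisGroup_eq (h : IsExponentialExtension φ Φ α u) {σ : galoisGroup k Φ} {c : kˣ}
    (hσ : (σ : L ≃ₐ[k] L) u = algebraMap k L c * u) : orderOf σ = orderOf c := by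
  have := h.nontrivial
  rw [orderOf_eq_orderOf_iff]
  intro n
  constructor
  · intro hn
    have h1 := pow_apply_unit hσ n
    rw [hn, Subgroup.coe_one, AlgEquiv.one_apply] at h1
    have h2 : algebraMap k L ((c ^ n : kˣ) : k) = 1 :=
      (Units.mul_left_inj u).1 (by rw [← h1, one_mul])
    exact Units.ext ((algebraMap k L).injective (by rw [h2, Units.val_one, map_one]))
  · intro hn
    apply h.galoisGroup_ext
    rw [pow_apply_unit hσ n, hn]
    simp

end IsExponentialExtension

end DifferenceGalois

namespace DifferenceGalois

open Polynomial

/-! ### Roots of unity and roots of constants are constants -/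

section RootsOfUnity

variable {k : Type*} [Field k] [CharZero k] {φ : k ≃+* k} [IsAlgClosed (constants φ)]

theorem exists_isPrimitiveRoot_fixed (φ : k ≃+* k) [IsAlgClosed (constants φ)] {n : ℕ}
    (hn : 0 < n) : ∃ ξ : kˣ, IsPrimitiveRoot ξ n ∧ φ ξ = ξ := by
  have : NeZero n := ⟨hn.ne'⟩
  have : CharZero (constants φ) := (constants φ).subtype.charZero
  obtain ⟨ξ, hξ⟩ := HasEnoughRootsOfUnity.exists_primitiveRoot (constants φ) n
  have hξ' : IsPrimitiveRoot (ξ : k) n :=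
    hξ.map_of_injective (f := (constants φ).subtype) (constants φ).subtype.injective
  refine ⟨(hξ'.isUnit hn.ne').unit, ?_, ?_⟩
  · exact IsPrimitiveRoot.coe_units_iff.1 (by simpa using hξ')
  · exact ξ.2

theorem map_eq_self_of_pow_eq_one {ω : k} {n : ℕ} (hn : 0 < n) (hω : ω ^ n = 1) : φ ω = ω := by
  obtain ⟨ξ, hξ, hφ⟩ := exists_isPrimitiveRoot_fixed φ hn
  have : NeZero n := ⟨hn.ne'⟩
  obtain ⟨i, -, hi⟩ := (IsPrimitiveRoot.coe_units_iff.2 hξ).eq_pow_of_pow_eq_one hω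
  rw [← hi, map_pow, hφ]

theorem map_eq_self_of_map_pow_eq {x : k} {n : ℕ} (hn : 0 < n) (hx : φ (x ^ n) = x ^ n) :
    φ x = x := by
  rcases eq_or_ne x 0 with rfl | hx0
  · exact map_zero φ
  obtain ⟨b, hb⟩ := IsAlgClosed.exists_pow_nat_eq (⟨x ^ n, hx⟩ : constants φ) hn
  have hb' : (b : k) ^ n = x ^ n := congrArg Subtype.val hb
  have hb0 : (b : k) ≠ 0 := fun h0 => by
    rw [h0, zero_pow hn.ne'] at hb'
    exact pow_ne_zero n hx0 hb'.symm
  have h1 : φ (x / b) = x / b := map_eq_self_of_pow_eq_one hn (by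
    rw [div_pow, hb', div_self (pow_ne_zero n hx0)])
  have h2 : φ (b : k) = b := b.2
  rw [map_div₀, h2] at h1
  exact (div_left_inj' hb0).1 h1

end RootsOfUnity

/-! ### Extraction of roots in `k` -/

section FiniteExtension

theorem adjoin_simple_map_mem {k : Type*} {K : Type*} [Field k] [Field K] [Algebra k K]
    {ψ : k ≃+* k} {Ψ : K ≃+* K} (hΨ : Extends ψ Ψ) {h : K} {c : k}
    (hh : Ψ h = algebraMap k K c * h) {x : K} (hx : x ∈ IntermediateField.adjoin k {h}) :
    Ψ x ∈ IntermediateField.adjoin k {h} := by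
  induction hx using IntermediateField.adjoin_induction with
  | mem x hx =>
    obtain rfl : x = h := hx
    rw [hh]
    exact mul_mem (IntermediateField.algebraMap_mem _ _)
      (IntermediateField.mem_adjoin_simple_self k x)
  | algebraMap x =>
    rw [hΨ]
    exact IntermediateField.algebraMap_mem _ _
  | add x y _ _ hx hy => rw [map_add]; exact add_mem hx hy
  | inv x _ hx => rw [map_inv₀]; exact inv_mem hx
  | mul x y _ _ hx hy => rw [map_mul]; exact mul_mem hx hy

variable {k : Type*} [Field k] [CharZero k] {φ : k ≃+* k} [IsAlgClosed (constants φ)]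

/-- Let `h` be an `n`-th root of `g` in the algebraic closure. Any extension of `φ` maps `h` to a
`k`-multiple of `h`, so `k(h)` is a finite difference extension and equals `k`. -/
theorem NoProperFiniteExtension.exists_pow_eq (hfin : NoProperFiniteExtension φ) {n : ℕ}
    (hn : 0 < n) {α g : k} (hα : α ≠ 0) (hg : g ≠ 0) (hφ : φ g = α ^ n * g) :
    ∃ y : k, y ^ n = g := by
  let Kbar := AlgebraicClosure k
  obtain ⟨h, hh⟩ := IsAlgClosed.exists_pow_nat_eq (algebraMap k Kbar g) hn
  let Ψ : Kbar ≃+* Kbar := IsAlgClosure.equivOfEquiv Kbar Kbar φ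
  have hΨ : Extends φ Ψ := fun x => IsAlgClosure.equivOfEquiv_algebraMap Kbar Kbar φ x
  have hΨ' : Extends φ.symm Ψ.symm := fun x => by
    rw [RingEquiv.symm_apply_eq, hΨ, RingEquiv.apply_symm_apply]
  have hg' : algebraMap k Kbar g ≠ 0 := (_root_.map_ne_zero _).2 hg
  have hα' : algebraMap k Kbar α ≠ 0 := (_root_.map_ne_zero _).2 hα
  have hh0 : h ≠ 0 := fun h0 => hg' (by rw [← hh, h0, zero_pow hn.ne'])
  obtain ⟨ξ, hξ, -⟩ := exists_isPrimitiveRoot_fixed φ hn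
  have : NeZero n := ⟨hn.ne'⟩
  have hξ' : IsPrimitiveRoot (algebraMap k Kbar ξ) n :=
    (IsPrimitiveRoot.coe_units_iff.2 hξ).map_of_injective (algebraMap k Kbar).injective
  -- Both `Ψ h` and `α h` are `n`-th roots of `φ g`, so they differ by a root of unity, which lies
  -- in `k`.
  obtain ⟨i, -, hi⟩ := hξ'.eq_pow_of_pow_eq_one (ξ := Ψ h / (algebraMap k Kbar α * h)) (by
    rw [div_pow, ← map_pow, hh, hΨ, hφ, mul_pow, hh, ← map_pow, ← map_mul, div_self]
    rw [map_mul, map_pow]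
    exact mul_ne_zero (pow_ne_zero _ hα') hg')
  set c : k := ξ ^ i * α with hc
  have hc0 : c ≠ 0 := mul_ne_zero (pow_ne_zero _ ξ.ne_zero) hα
  have hΨh : Ψ h = algebraMap k Kbar c * h := by
    rw [hc, map_mul, map_pow, hi, mul_assoc, div_mul_cancel₀ _ (mul_ne_zero hα' hh0)]
  have hΨh' : Ψ.symm h = algebraMap k Kbar (φ.symm c⁻¹) * h := by
    rw [RingEquiv.symm_apply_eq, map_mul, hΨ, RingEquiv.apply_symm_apply, hΨh, ← mul_assoc,
      ← map_mul, inv_mul_cancel₀ hc0, map_one, one_mul]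
  let K := IntermediateField.adjoin k {h}
  have hint : IsIntegral k h := Algebra.IsIntegral.isIntegral h
  have : FiniteDimensional k K := IntermediateField.adjoin.finiteDimensional hint
  let Φ : K ≃+* K :=
    { toFun := fun x => ⟨Ψ x, adjoin_simple_map_mem hΨ hΨh x.2⟩
      invFun := fun x => ⟨Ψ.symm x, adjoin_simple_map_mem hΨ' hΨh' x.2⟩
      left_inv := fun x => Subtype.ext (Ψ.symm_apply_apply x)
      right_inv := fun x => Subtype.ext (Ψ.apply_symm_apply x)
      map_mul' := fun x y => Subtype.ext (map_mul Ψ (x : Kbar) y)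
      map_add' := fun x y => Subtype.ext (map_add Ψ (x : Kbar) y) }
  obtain ⟨y, hy⟩ := hfin K Φ (fun x => Subtype.ext (hΨ x))
    ⟨h, IntermediateField.mem_adjoin_simple_self k h⟩
  refine ⟨y, (algebraMap k Kbar).injective ?_⟩
  rw [map_pow, ← hh]
  exact congrArg (· ^ n) (congrArg Subtype.val hy)

end FiniteExtension

/-! ### Degree of the generator and the Galois group -/

namespace IsExponentialExtension

variable {k : Type*} {L : Type*} [Field k] [CommRing L] [Algebra k L] {φ : k ≃+* k} {Φ : L ≃+* L}
  {α : kˣ} {u : Lˣ}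

theorem map_unit_pow (h : IsExponentialExtension φ Φ α u) (n : ℕ) :
    Φ ((u : L) ^ n) = algebraMap k L (α ^ n : k) * u ^ n := by
  rw [map_pow, h.map_unit, mul_pow, map_pow]

theorem isIntegral_of_pow_eq {x : L} {n : ℕ} (hn : 0 < n) {e : k}
    (hx : x ^ n = algebraMap k L e) : IsIntegral k x :=
  IsIntegral.of_pow hn (hx ▸ isIntegral_algebraMap)

theorem natDegree_minpoly_le {x : L} {n : ℕ} (hn : 0 < n) {e : k}
    (hx : x ^ n = algebraMap k L e) : (minpoly k x).natDegree ≤ n := by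
  have h1 := minpoly.min k x (monic_X_pow_sub_C e hn.ne') (by simp [hx])
  exact (natDegree_le_natDegree h1).trans_eq (natDegree_X_pow_sub_C)

theorem map_base_of_pow_eq (h : IsExponentialExtension φ Φ α u) {n : ℕ} {g : k}
    (hg : (u : L) ^ n = algebraMap k L g) : φ g = α ^ n * g := by
  have := h.nontrivial
  apply (algebraMap k L).injective
  rw [← h.extends_base, ← hg, h.map_unit_pow, map_mul, hg]

theorem minpoly_eq (h : IsExponentialExtension φ Φ α u) (hu : IsIntegral k (u : L)) {g : k}
    (hg : (u : L) ^ (minpoly k (u : L)).natDegree = algebraMap k L g) :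
    minpoly k (u : L) = X ^ (minpoly k (u : L)).natDegree - C g := by
  have := h.nontrivial
  have hd := minpoly.natDegree_pos hu
  symm
  apply minpoly.unique_of_degree_le_degree_minpoly k (u : L) (monic_X_pow_sub_C g hd.ne')
  · simp [hg]
  · rw [degree_X_pow_sub_C hd, degree_eq_natDegree (minpoly.ne_zero hu)]

theorem isIntegral_of_finite_galoisGroup [CharZero k]
    (h : IsExponentialExtension φ Φ α u) [Finite (galoisGroup k Φ)] : IsIntegral k (u : L) := by
  by_contra hu
  have htr : ∀ p : k[X], aeval (u : L) p = 0 → p = 0 := by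
    intro p hp
    by_contra hp0
    exact hu (IsAlgebraic.isIntegral ⟨p, hp0, hp⟩)
  -- In characteristic zero, 2 is a constant of infinite multiplicative order.
  obtain ⟨σ, hσ⟩ := h.exists_mem_galoisGroup (Units.mk0 2 two_ne_zero) (map_ofNat φ 2)
    (fun p hp => by rw [htr p hp, map_zero]) (fun p hp => by rw [htr p hp, map_zero])
  have h1 := orderOf_pos σ
  rw [h.orderOf_galoisGroup_eq hσ] at h1
  have h2 := congrArg Units.val (pow_orderOf_eq_one (Units.mk0 (2 : k) two_ne_zero))
  rw [Units.val_pow_eq_pow_val, Units.val_mk0, Units.val_one] at h2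
  have h3 : 2 ^ orderOf (Units.mk0 (2 : k) two_ne_zero) = 1 := by exact_mod_cast h2
  exact h1.ne' ((Nat.pow_eq_one.1 h3).resolve_left (by norm_num))

/-- The element `a⁻¹ u ^ n - 1` is invariant. Were `u` transcendental, it would be a nonzero
invariant, hence a unit, and `a⁻¹ X ^ n - 1` would divide a power of `X`, to which it is coprime. -/
theorem isIntegral_of_map_eq (h : IsExponentialExtension φ Φ α u) {n : ℕ} (hn : 0 < n) {a : kˣ}
    (ha : φ (a : k) = α ^ n * a) : IsIntegral k (u : L) := by
  have := h.nontrivial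
  by_contra hu
  have htr : ∀ p : k[X], aeval (u : L) p = 0 → p = 0 := by
    intro p hp
    by_contra hp0
    exact hu (IsAlgebraic.isIntegral ⟨p, hp0, hp⟩)
  have ha' : φ ((a : k)⁻¹) * α ^ n = (a : k)⁻¹ := by
    rw [map_inv₀, ha]
    field_simp
  set r : k[X] := C ((a : k)⁻¹) * X ^ n - 1 with hr
  have hru : aeval (u : L) r = algebraMap k L ((a : k)⁻¹) * u ^ n - 1 := by simp [hr]
  have hdeg : r.natDegree = n := by
    rw [hr, ← C_1, natDegree_sub_C, natDegree_C_mul_X_pow _ _ (inv_ne_zero a.ne_zero)]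
  rcases h.eq_zero_or_isUnit_of_constant (x := aeval (u : L) r) (by
    rw [hru, map_sub, map_one, map_mul, h.map_unit_pow, h.extends_base, ← mul_assoc, ← map_mul,
      ha']) with h0 | hunit
  · have := htr r h0
    rw [this, natDegree_zero] at hdeg
    omega
  · obtain ⟨y, hy⟩ := hunit.exists_right_inv
    obtain ⟨N, q, hq⟩ := h.exists_mul_pow_eq_aeval y
    have h1 : r * q - X ^ N = 0 := htr _ (by
      rw [map_sub, map_mul, ← hq, ← mul_assoc, hy, one_mul, map_pow, aeval_X, sub_self])
    have hdvd : r ∣ X ^ N := ⟨q, (sub_eq_zero.1 h1).symm⟩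
    obtain ⟨m, rfl⟩ : ∃ m, n = m + 1 := ⟨n - 1, by omega⟩
    have hcop : IsCoprime r (X ^ N) := by
      apply IsCoprime.pow_right
      exact ⟨-1, C ((a : k)⁻¹) * X ^ m, by rw [hr]; ring⟩
    have := natDegree_eq_zero_of_isUnit (hcop.isUnit_of_dvd' dvd_rfl hdvd)
    omega

variable [IsAlgClosed (constants φ)]

theorem exists_pow_eq_of_constant (h : IsExponentialExtension φ Φ α u)
    (hu : IsIntegral k (u : L)) {n : ℕ} {a : kˣ} (ha : φ (a : k) = α ^ n * a) :
    ∃ g : kˣ, (u : L) ^ n = algebraMap k L g := by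
  have := h.nontrivial
  have ha' : φ ((a : k)⁻¹) * α ^ n = (a : k)⁻¹ := by
    rw [map_inv₀, ha]
    field_simp
  obtain ⟨c, hc⟩ := h.exists_constant_of_isIntegral (x := algebraMap k L ((a : k)⁻¹) * u ^ n)
    (by rw [map_mul, h.map_unit_pow, h.extends_base, ← mul_assoc, ← map_mul, ha'])
    (isIntegral_algebraMap.mul (hu.pow n))
  have hg : (u : L) ^ n = algebraMap k L (a * c) := by
    rw [map_mul, ← hc, ← mul_assoc, ← map_mul, mul_inv_cancel₀ a.ne_zero, map_one, one_mul]
  have h0 : (a * c : k) ≠ 0 := fun h0 => by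
    rw [h0, map_zero] at hg
    exact (u ^ n).ne_zero (by simpa using hg)
  exact ⟨Units.mk0 _ h0, hg⟩

theorem exists_pow_natDegree_eq (h : IsExponentialExtension φ Φ α u)
    (hu : IsIntegral k (u : L)) :
    ∃ g : kˣ, (u : L) ^ (minpoly k (u : L)).natDegree = algebraMap k L g := by
  have := h.nontrivial
  -- Since `u` is a unit, a factor `X` could be cancelled, contradicting minimality.
  have h0 : (minpoly k (u : L)).coeff 0 ≠ 0 := by
    intro h0
    obtain ⟨q, hq⟩ := X_dvd_iff.2 h0
    have hm := minpoly.monic hu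
    rw [hq] at hm
    have hqm : q.Monic := monic_X.of_mul_monic_left hm
    have haq : aeval (u : L) q = 0 := by
      have h1 := minpoly.aeval k (u : L)
      rw [hq, map_mul, aeval_X] at h1
      exact (Units.mul_right_eq_zero u).1 h1
    have h2 := natDegree_le_natDegree (minpoly.min k (u : L) hqm haq)
    rw [hq, natDegree_X_mul hqm.ne_zero] at h2
    omega
  have h1 := map_coeff_minpoly h.extends_base hu α.ne_zero h.map_unit 0
  rw [Nat.sub_zero] at h1
  exact h.exists_pow_eq_of_constant hu (a := Units.mk0 _ h0) h1

theorem exists_galoisGroup_of_pow_eq_one (h : IsExponentialExtension φ Φ α u)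
    (hu : IsIntegral k (u : L)) {ξ : kˣ} (hφ : φ ξ = ξ)
    (hξ : ξ ^ (minpoly k (u : L)).natDegree = 1) :
    ∃ σ : galoisGroup k Φ, (σ : L ≃ₐ[k] L) u = algebraMap k L ξ * u := by
  obtain ⟨g, hg⟩ := h.exists_pow_natDegree_eq hu
  have key : ∀ η : kˣ, η ^ (minpoly k (u : L)).natDegree = 1 →
      ∀ p : k[X], aeval (u : L) p = 0 → aeval (algebraMap k L η * u) p = 0 := by
    intro η hη p hp
    obtain ⟨q, rfl⟩ := minpoly.dvd k (u : L) hp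
    rw [map_mul]
    have h0 : aeval (algebraMap k L η * u) (minpoly k (u : L)) = 0 := by
      rw [h.minpoly_eq hu hg]
      rw [map_sub, map_pow, aeval_X, aeval_C, mul_pow, hg, ← map_pow, ← Units.val_pow_eq_pow_val,
        hη, Units.val_one, map_one, one_mul, sub_self]
    rw [h0, zero_mul]
  exact h.exists_mem_galoisGroup ξ hφ (key ξ hξ) (key ξ⁻¹ (by rw [inv_pow, hξ, inv_one]))

theorem exists_apply_unit_eq (h : IsExponentialExtension φ Φ α u) (hu : IsIntegral k (u : L))
    (σ : galoisGroup k Φ) : ∃ c : kˣ, c ^ (minpoly k (u : L)).natDegree = 1 ∧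
      (σ : L ≃ₐ[k] L) u = algebraMap k L c * u := by
  have := h.nontrivial
  obtain ⟨g, hg⟩ := h.exists_pow_natDegree_eq hu
  have hd := minpoly.natDegree_pos hu
  set d := (minpoly k (u : L)).natDegree
  set x : L := (σ : L ≃ₐ[k] L) u * ((u⁻¹ : Lˣ) : L) with hx
  -- The ratio `x = σ u / u` is invariant because `σ u` and `u` solve the same equation, and `x ^ d
  -- = 1` makes it integral.
  have hxu : (σ : L ≃ₐ[k] L) u = x * u := by rw [hx, mul_assoc, Units.inv_mul, mul_one]
  have hxd : x ^ d = 1 := by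
    have h1 : ((σ : L ≃ₐ[k] L) u) ^ d = (u : L) ^ d := by
      rw [← map_pow, hg, AlgEquiv.commutes]
    rw [hx, mul_pow, h1, ← mul_pow, Units.mul_inv, one_pow]
  have hxc : Φ x = x := by
    have h1 : Φ ((σ : L ≃ₐ[k] L) u) = algebraMap k L α * (σ : L ≃ₐ[k] L) u := by
      rw [← σ.2 u, h.map_unit, map_mul, AlgEquiv.commutes]
    rw [hxu, map_mul, h.map_unit, mul_left_comm] at h1
    have h2 := (Units.mul_right_inj (Units.map (algebraMap k L : k →* L) α)).1 h1
    exact (Units.mul_left_inj u).1 h2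
  obtain ⟨c, hc⟩ := h.exists_constant_of_isIntegral hxc
    (isIntegral_of_pow_eq hd (e := 1) (by rw [hxd, map_one]))
  have hcd : (c : k) ^ d = 1 := by
    apply (algebraMap k L).injective
    rw [map_pow, ← hc, hxd, map_one]
  refine ⟨Units.ofPowEqOne (c : k) d hcd hd.ne', Units.ext (by simp), ?_⟩
  rw [hxu, hc]
  rfl

variable [CharZero k]

theorem nonempty_galoisGroup_mulEquiv (h : IsExponentialExtension φ Φ α u)
    (hu : IsIntegral k (u : L)) : Nonempty (galoisGroup k Φ ≃*
      Multiplicative (ZMod (minpoly k (u : L)).natDegree)) := by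
  have := h.nontrivial
  have hd := minpoly.natDegree_pos hu
  obtain ⟨ξ, hξ, hφ⟩ := exists_isPrimitiveRoot_fixed φ hd
  have : NeZero (minpoly k (u : L)).natDegree := ⟨hd.ne'⟩
  obtain ⟨σ, hσ⟩ := h.exists_galoisGroup_of_pow_eq_one hu hφ hξ.pow_eq_one
  have hgen : ∀ τ : galoisGroup k Φ, τ ∈ Subgroup.zpowers σ := by
    intro τ
    obtain ⟨c, hc, hτ⟩ := h.exists_apply_unit_eq hu τ
    obtain ⟨i, -, hi⟩ := (IsPrimitiveRoot.coe_units_iff.2 hξ).eq_pow_of_pow_eq_one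
      (ξ := (c : k)) (by rw [← Units.val_pow_eq_pow_val, hc, Units.val_one])
    refine ⟨i, ?_⟩
    simp only [zpow_natCast]
    apply h.galoisGroup_ext
    rw [pow_apply_unit hσ, hτ, Units.val_pow_eq_pow_val, hi]
  have : IsCyclic (galoisGroup k Φ) := ⟨σ, hgen⟩
  refine ⟨mulEquivOfCyclicCardEq ?_⟩
  rw [← orderOf_eq_card_of_forall_mem_zpowers hgen, h.orderOf_galoisGroup_eq hσ, ← hξ.eq_orderOf]
  simp

/-- The element `f ^ (-n)` solves the equation of `u ^ n`, which gives integrality and `u ^ n ∈ k`,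
so `d ≤ n`. Conversely, `u ^ d = g` makes `g f ^ d` an eigenvector with eigenvalue `ζ ^ d`. Its
`n`-th power is constant, so it is constant itself, and `n ∣ d`. -/
theorem natDegree_minpoly_eq (h : IsExponentialExtension φ Φ α u) {n : ℕ} (hn : 0 < n)
    {ζ f : kˣ} (hζ : IsPrimitiveRoot ζ n) (hf : φ (f : k) = ζ / α * f) :
    IsIntegral k (u : L) ∧ (minpoly k (u : L)).natDegree = n := by
  have := h.nontrivial
  have hpow : ∀ m : ℕ, φ ((f : k) ^ m) * α ^ m = ζ ^ m * f ^ m := fun m => by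
    rw [map_pow, hf, ← mul_pow, ← mul_pow]
    congr 1
    field_simp
  have hζn : (ζ : k) ^ n = 1 := by
    rw [← Units.val_pow_eq_pow_val, hζ.pow_eq_one, Units.val_one]
  have ha : φ (((f ^ n)⁻¹ : kˣ) : k) = α ^ n * ((f ^ n)⁻¹ : kˣ) := by
    have h1 := hpow n
    rw [hζn, one_mul] at h1
    have h2 : φ ((f : k) ^ n) ≠ 0 := (_root_.map_ne_zero φ).2 (pow_ne_zero _ f.ne_zero)
    rw [Units.val_inv_eq_inv_val, Units.val_pow_eq_pow_val, map_inv₀, inv_eq_iff_eq_inv, mul_inv,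
      inv_inv, eq_inv_mul_iff_mul_eq₀ (pow_ne_zero _ α.ne_zero), mul_comm, h1]
  have hu := h.isIntegral_of_map_eq hn ha
  refine ⟨hu, le_antisymm ?_ ?_⟩
  · obtain ⟨g, hg⟩ := h.exists_pow_eq_of_constant hu ha
    exact natDegree_minpoly_le hn hg
  · obtain ⟨g, hg⟩ := h.exists_pow_natDegree_eq hu
    have hd := minpoly.natDegree_pos hu
    set d := (minpoly k (u : L)).natDegree
    have he : φ ((g : k) * f ^ d) = ζ ^ d * (g * f ^ d) := by
      rw [map_mul, h.map_base_of_pow_eq hg]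
      linear_combination (g : k) * hpow d
    have he' : φ ((g : k) * f ^ d) = g * f ^ d := map_eq_self_of_map_pow_eq hn (by
      rw [map_pow, he, mul_pow, ← pow_mul, mul_comm d n, pow_mul, hζn, one_pow, one_mul])
    have h0 : (g * f ^ d : k) ≠ 0 := mul_ne_zero g.ne_zero (pow_ne_zero _ f.ne_zero)
    have hζd : (ζ : k) ^ d = 1 := mul_right_cancel₀ h0 (by rw [← he, he', one_mul])
    exact Nat.le_of_dvd hd (hζ.dvd_of_pow_eq_one d (Units.ext (by simpa using hζd)))

theorem exists_isPrimitiveRoot_of_natDegree (h : IsExponentialExtension φ Φ α u)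
    (hfin : NoProperFiniteExtension φ) (hu : IsIntegral k (u : L)) :
    ∃ ζ f : kˣ, IsPrimitiveRoot ζ (minpoly k (u : L)).natDegree ∧
      φ (f : k) = ζ / α * f := by
  have := h.nontrivial
  obtain ⟨g, hg⟩ := h.exists_pow_natDegree_eq hu
  have hd := minpoly.natDegree_pos hu
  set d := (minpoly k (u : L)).natDegree with hdd
  have hφg := h.map_base_of_pow_eq hg
  obtain ⟨y, hy⟩ := hfin.exists_pow_eq hd α.ne_zero g.ne_zero hφg
  have hy0 : y ≠ 0 := fun h0 => g.ne_zero (by rw [← hy, h0, zero_pow hd.ne'])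
  have hφy : φ y ≠ 0 := (_root_.map_ne_zero φ).2 hy0
  set ζ : kˣ := Units.mk0 (α * y / φ y) (div_ne_zero (mul_ne_zero α.ne_zero hy0) hφy) with hζ
  have hf : φ (((Units.mk0 y hy0)⁻¹ : kˣ) : k) = ζ / α * ((Units.mk0 y hy0)⁻¹ : kˣ) := by
    rw [hζ, Units.val_inv_eq_inv_val, Units.val_mk0, Units.val_mk0, map_inv₀]
    field_simp
  have hζd : ζ ^ d = 1 := by
    apply Units.ext
    rw [Units.val_pow_eq_pow_val, hζ, Units.val_mk0, div_pow, mul_pow, ← map_pow, hy, hφg,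
      Units.val_one, div_self (mul_ne_zero (pow_ne_zero _ α.ne_zero) g.ne_zero)]
  -- So far the order of `ζ` only divides `d`; the degree formula applied to that order shows that
  -- they are equal.
  have hpos : 0 < orderOf ζ := orderOf_pos_iff.2 (isOfFinOrder_iff_pow_eq_one.2 ⟨d, hd, hζd⟩)
  have hord := (h.natDegree_minpoly_eq hpos (IsPrimitiveRoot.orderOf ζ) hf).2
  exact ⟨ζ, _, by rw [hdd, hord]; exact IsPrimitiveRoot.orderOf ζ, hf⟩

theorem nonempty_galoisGroup_mulEquiv_iff (h : IsExponentialExtension φ Φ α u)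
    (hfin : NoProperFiniteExtension φ) {n : ℕ} (hn : 0 < n) :
    Nonempty (galoisGroup k Φ ≃* Multiplicative (ZMod n)) ↔
      ∃ ζ f : kˣ, IsPrimitiveRoot ζ n ∧ φ (f : k) = ζ / α * f := by
  constructor
  · rintro ⟨e⟩
    have : NeZero n := ⟨hn.ne'⟩
    have : Finite (galoisGroup k Φ) := Finite.of_equiv _ e.toEquiv.symm
    have hu := h.isIntegral_of_finite_galoisGroup
    obtain ⟨e'⟩ := h.nonempty_galoisGroup_mulEquiv hu
    have hcard := Nat.card_congr (e'.symm.trans e).toEquiv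
    simp only [Nat.card_eq_of_bijective _ Multiplicative.toAdd.bijective, Nat.card_zmod] at hcard
    rw [← hcard]
    exact h.exists_isPrimitiveRoot_of_natDegree hfin hu
  · rintro ⟨ζ, f, hζ, hf⟩
    obtain ⟨hu, hd⟩ := h.natDegree_minpoly_eq hn hζ hf
    exact hd ▸ h.nonempty_galoisGroup_mulEquiv hu

end IsExponentialExtension

end DifferenceGalois

namespace DifferenceGalois

/-! ### Translation to systems of size one and reduced forms -/

section OrderOne

theorem eq_scalar_det {R : Type*} [CommRing R] (U : GL (Fin 1) R) :
    U = Matrix.GeneralLinearGroup.scalar (Fin 1) (Matrix.GeneralLinearGroup.det U) := by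
  ext i j
  fin_cases i; fin_cases j
  simp [Matrix.GeneralLinearGroup.scalar]

theorem scalar_fin_one_apply {R : Type*} [CommRing R] (u : Rˣ) (i j : Fin 1) :
    (Matrix.GeneralLinearGroup.scalar (Fin 1) u).val i j = u := by
  fin_cases i; fin_cases j
  simp [Matrix.GeneralLinearGroup.scalar]

variable {k : Type*} {L : Type*} [Field k] [CommRing L] [Algebra k L] {φ : k ≃+* k} {Φ : L ≃+* L}

theorem isFundamentalMatrix_orderOne_iff {α : kˣ} {u : Lˣ} :
    IsFundamentalMatrix Φ (orderOne α) (Matrix.GeneralLinearGroup.scalar (Fin 1) u) ↔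
      Φ u = algebraMap k L α * u := by
  rw [IsFundamentalMatrix, ← Matrix.ext_iff]
  simp [orderOne, Matrix.mul_apply, scalar_fin_one_apply, -Matrix.GeneralLinearGroup.coe_scalar]

theorem generators_scalar (u : Lˣ) :
    Set.range (fun p : Fin 1 × Fin 1 =>
        (Matrix.GeneralLinearGroup.scalar (Fin 1) u).val p.1 p.2) ∪
      {((Matrix.GeneralLinearGroup.scalar (Fin 1) u)⁻¹).val.det} =
      {(u : L), ((u⁻¹ : Lˣ) : L)} := by
  rw [← map_inv]
  simp only [scalar_fin_one_apply, Set.range_const, Matrix.det_unique]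
  rfl

theorem isPicardVessiotRing_orderOne_iff {α : kˣ} :
    IsPicardVessiotRing φ Φ (orderOne α) ↔ ∃ u : Lˣ, IsExponentialExtension φ Φ α u := by
  constructor
  · rintro ⟨h1, h2, ⟨U, hU, hgen⟩, h4⟩
    rw [eq_scalar_det U] at hU hgen
    rw [generators_scalar] at hgen
    exact ⟨_, h1, h2, isFundamentalMatrix_orderOne_iff.1 hU, hgen, h4⟩
  · rintro ⟨u, h⟩
    exact ⟨h.nontrivial, h.extends_base, ⟨_, isFundamentalMatrix_orderOne_iff.2 h.map_unit, by
      rw [generators_scalar]; exact h.adjoin_eq_top⟩, h.simple⟩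

/-- The same `(L, Φ)` serves both equations: `f` is a unit of `k`, so `f u` and its inverse generate
the same algebra. -/
theorem IsExponentialExtension.gauge {α ζ f : kˣ} {u : Lˣ}
    (h : IsExponentialExtension φ Φ α u) (hf : φ (f : k) = ζ / α * f) :
    IsExponentialExtension φ Φ ζ (Units.map (algebraMap k L : k →* L) f * u) where
  nontrivial := h.nontrivial
  extends_base := h.extends_base
  map_unit := by
    simp only [Units.val_mul, Units.coe_map, MonoidHom.coe_coe]
    rw [map_mul, h.map_unit, h.extends_base, hf, ← mul_assoc, ← mul_assoc, ← map_mul, ← map_mul]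
    congr 2
    field_simp
  adjoin_eq_top := by
    rw [eq_top_iff, ← h.adjoin_eq_top, Algebra.adjoin_le_iff]
    set v : Lˣ := Units.map (algebraMap k L : k →* L) f * u with hv
    set S := Algebra.adjoin k {(v : L), ((v⁻¹ : Lˣ) : L)}
    have hvS : (v : L) ∈ S := Algebra.subset_adjoin (by simp)
    have hvS' : ((v⁻¹ : Lˣ) : L) ∈ S := Algebra.subset_adjoin (by simp)
    have hu : u = Units.map (algebraMap k L : k →* L) f⁻¹ * v := by
      rw [hv, ← mul_assoc, ← map_mul, inv_mul_cancel, map_one, one_mul]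
    have hu' : u⁻¹ = Units.map (algebraMap k L : k →* L) f * v⁻¹ := by
      rw [hu, mul_inv, ← map_inv, inv_inv]
    rintro x (rfl | rfl)
    · rw [hu]
      exact mul_mem (S.algebraMap_mem _) hvS
    · rw [hu']
      exact mul_mem (S.algebraMap_mem _) hvS'
  simple := h.simple

theorem gaugeTransform_orderOne {α ζ f : kˣ} (hf : φ (f : k) = ζ / α * f) :
    orderOne ζ = gaugeTransform φ (orderOne f) (orderOne α) := by
  have hmap : Matrix.GeneralLinearGroup.map (φ : k →+* k) (orderOne f) =
      orderOne (Units.map (φ : k →* k) f) := by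
    ext i j
    rw [Matrix.GeneralLinearGroup.map_apply]
    simp only [orderOne, scalar_fin_one_apply]
    rfl
  rw [gaugeTransform, hmap, orderOne, orderOne, orderOne, orderOne, ← map_inv, ← map_mul,
    ← map_mul]
  congr 1
  ext
  simp only [Units.val_mul, Units.coe_map, MonoidHom.coe_coe, Units.val_inv_eq_inv_val]
  rw [hf]
  field_simp

/-- The matrix of `σ` is `(c)` itself, so every polynomial vanishing on the image vanishes at `c`.
-/
theorem orderOne_mem_points_galoisImage {c : kˣ} (hc : φ c = c) {v : Lˣ} {σ : galoisGroup k Φ}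
    (hσ : (σ : L ≃ₐ[k] L) v = algebraMap k L c * v) :
    orderOne c ∈ points φ (galoisImage φ Φ (Matrix.GeneralLinearGroup.scalar (Fin 1) v)) := by
  intro P hP
  have hc0 : (⟨c, hc⟩ : constants φ) ≠ 0 := fun h0 => c.ne_zero (congrArg Subtype.val h0)
  have h1 := hP (Matrix.GeneralLinearGroup.scalar (Fin 1) (Units.mk0 ⟨c, hc⟩ hc0))
    ⟨σ, σ.2, by
      rw [← map_inv]
      ext i j
      simp only [Matrix.mul_apply, Matrix.map_apply, scalar_fin_one_apply, Finset.univ_unique,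
        Finset.sum_singleton, hσ, Units.val_mk0]
      rw [mul_left_comm, Units.inv_mul, mul_one]⟩
  have h2 := congrArg (algebraMap (constants φ) k) h1
  rw [map_zero, ← MvPolynomial.coe_aeval_eq_eval, RingHom.coe_coe,
    ← MvPolynomial.aeval_algebraMap_apply] at h2
  rw [← h2]
  congr 2
  funext p
  simp only [Function.comp_apply, orderOne, scalar_fin_one_apply]
  rfl

end OrderOne

end DifferenceGalois

theorem mainTheorem11 {k : Type*} [Field k] [CharZero k] (φ : k ≃+* k)
    (hC : IsAlgClosed (DifferenceGalois.constants φ))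
    (hC1 : DifferenceGalois.IsC1Field k)
    (hfin : DifferenceGalois.NoProperFiniteExtension φ)
    (α : kˣ) (ℓ : ℕ) (hℓ : 0 < ℓ)
    {L : Type*} [CommRing L] [Algebra k L] (Φ : L ≃+* L)
    (hL : DifferenceGalois.IsPicardVessiotRing φ Φ (DifferenceGalois.orderOne α)) :
    (Nonempty (DifferenceGalois.galoisGroup k Φ ≃* Multiplicative (ZMod ℓ)) ↔
      ∃ ζ f : kˣ, IsPrimitiveRoot ζ ℓ ∧ φ (f : k) = ((ζ : k) / (α : k)) * (f : k)) ∧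
    ∀ ζ f : kˣ, IsPrimitiveRoot ζ ℓ → φ (f : k) = ((ζ : k) / (α : k)) * (f : k) →
      (ζ : k) = (α : k) * (φ (f : k) / (f : k)) ∧
      DifferenceGalois.IsReducedFormVia φ Φ (DifferenceGalois.orderOne α)
        (DifferenceGalois.orderOne ζ) (DifferenceGalois.orderOne f) := by
  obtain ⟨u, hu⟩ := DifferenceGalois.isPicardVessiotRing_orderOne_iff.1 hL
  refine ⟨hu.nonempty_galoisGroup_mulEquiv_iff hfin hℓ, fun ζ f hζ hf => ⟨?_, ?_, ?_, ?_⟩⟩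
  · rw [hf]
    field_simp
  · exact DifferenceGalois.gaugeTransform_orderOne hf
  · exact DifferenceGalois.isPicardVessiotRing_orderOne_iff.2 ⟨_, hu.gauge hf⟩
  · have hv := hu.gauge hf
    obtain ⟨hint, hd⟩ := hu.natDegree_minpoly_eq hℓ hζ hf
    have hζφ : φ (ζ : k) = ζ := DifferenceGalois.map_eq_self_of_pow_eq_one hℓ
      (by rw [← Units.val_pow_eq_pow_val, hζ.pow_eq_one, Units.val_one])
    -- This `σ` fixes `f`, so it scales the new solution `f u` by `ζ` as well.
    obtain ⟨σ, hσ⟩ := hu.exists_galoisGroup_of_pow_eq_one hint hζφ (by rw [hd, hζ.pow_eq_one])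
    refine ⟨_, DifferenceGalois.isFundamentalMatrix_orderOne_iff.2 hv.map_unit,
      DifferenceGalois.orderOne_mem_points_galoisImage hζφ (σ := σ) ?_⟩
    simp only [Units.val_mul, Units.coe_map, MonoidHom.coe_coe]
    rw [map_mul, AlgEquiv.commutes, hσ, mul_left_comm]
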